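/- For $n \ge 1$ let $\Pi_n$ be the lattice of all partitions of $\{1,\dots,n\}$, ordered by $\pi \le \pi'$ if every block of $\pi$ is contained in a block of $\pi'$. For a finite poset $L$ let $N$ be the largest cardinality of a chain of $L$, let $f_{i-1}(L)$ be the number of $i$-element chains of $L$ (so $f_{-1}(L)=1$, counting the empty chain), and let $$h_L(x) = \sum_{i=0}^{N} f_{i-1}(L)\, x^i (1-x)^{N-i}$$ be the $h$-polynomial of the order complex of $L$. A polynomial with real coefficients is called real-rooted if all its complex roots are real or it is the zero polynomial. A real-rooted polynomial $f$ with roots $\alpha_1 \ge \alpha_2 \ge \cdots$ (listed with multiplicity) interlaces a real-rooted polynomial $g$ with roots $\beta_1 \ge \beta_2 \ge \cdots$ if $$\cdots \le \alpha_2 \le \beta_2 \le \alpha_1 \le \beta_1$$ (so that $g$ has as many roots as $f$ or exactly one more); by convention, the zero polynomial interlaces and is interlaced by every real-rooted polynomial. Then, for every $n \ge 1$, the polynomial $h_{\Pi_n}(x)$ is real-rooted and it interlaces $h_{\Pi_{n+1}}(x)$. -/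

import Mathlib

open Polynomial

noncomputable section

/-- A real polynomial is real-rooted if all its complex roots are real, or if it is zero. -/
def RealRooted (f : ℝ[X]) : Prop :=
  f = 0 ∨ ∀ z : ℂ, aeval z f = 0 → z.im = 0

/-- The real roots of `f`, with multiplicity, in weakly decreasing order (empty for `f = 0`). -/
def decRoots (f : ℝ[X]) : List ℝ :=
  f.roots.sort (· ≥ ·)

/-- `f` interlaces `g`: both are real-rooted and, unless one of them is zero, their roots
`α₁ ≥ α₂ ≥ ⋯` (of `f`) and `β₁ ≥ β₂ ≥ ⋯` (of `g`) satisfy `⋯ ≤ α₂ ≤ β₂ ≤ α₁ ≤ β₁`.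
This alternating chain forces `g` to have as many roots as `f`, or exactly one more. -/
def Interlaces (f g : ℝ[X]) : Prop :=
  RealRooted f ∧ RealRooted g ∧
    (f = 0 ∨ g = 0 ∨
      (((decRoots g).length = (decRoots f).length ∨
          (decRoots g).length = (decRoots f).length + 1) ∧
        (∀ (i : ℕ) (hf : i < (decRoots f).length) (hg : i < (decRoots g).length),
          (decRoots f)[i] ≤ (decRoots g)[i]) ∧
        (∀ (i : ℕ) (hf : i < (decRoots f).length) (hg : i + 1 < (decRoots g).length),
          (decRoots g)[i + 1] ≤ (decRoots f)[i])))

open Classical in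
/-- The faces of the order complex of a finite poset: all its chains, including the empty one. -/
def orderComplex (L : Type*) [PartialOrder L] [Fintype L] : Finset (Finset L) :=
  Finset.univ.filter fun c => IsChain (· ≤ ·) (c : Set L)

/-- The number of `i`-element chains of `L`, i.e. the number of faces of dimension `i - 1`
of its order complex. -/
def chainCount (L : Type*) [PartialOrder L] [Fintype L] (i : ℕ) : ℕ :=
  ((orderComplex L).filter fun c => c.card = i).card

/-- The largest cardinality of a chain of `L`. -/
def maxChainCard (L : Type*) [PartialOrder L] [Fintype L] : ℕ :=
  (orderComplex L).sup Finset.card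

/-- The `h`-polynomial of the order complex of a finite poset `L`:
`∑ i = 0, …, N, f_{i-1} x ^ i (1 - x) ^ (N - i)`, with `N` the largest cardinality of a chain
and `f_{i-1}` the number of `i`-element chains. -/
def hPolynomial (L : Type*) [PartialOrder L] [Fintype L] : ℝ[X] :=
  ∑ i ∈ Finset.range (maxChainCard L + 1),
    C (chainCount L i : ℝ) * X ^ i * (1 - X) ^ (maxChainCard L - i)

/-- The partition lattice: all partitions of `{1, …, n}` into nonempty blocks, with `π ≤ π'`
when every block of `π` is contained in a block of `π'`. -/
abbrev PartitionLattice (n : ℕ) : Type :=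
  Finpartition (Finset.Icc 1 n)

end

/-! Write `F n` for the sum of `t ^ |c|` over the chains `c` of the partition lattice. Sorting
nonempty chains by their least element `π`, and using that the partitions above `π` form the
partition lattice on the blocks of `π`, gives `(1 + t) (F n - 1) = t ∑ π, F |π|`. At `t = x / (1 -
x)` this reads `F n = 1 + x ∑ π, F |π|`. Building partitions one element at a time (`stirlingOp`)
refines this relation into a triangular recursion with nonnegative coefficients, `refinedH`, whose
entry `refinedH m 0` is the `h`-polynomial for `m + 1` points (`hPolynomial_partitionLattice_succ`).

For `z` in the open upper half plane, the values `refinedH m 0, …, refinedH m m, z * refinedH m 0`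
turn counterclockwise within a half plane; the recursion preserves this (`ArgMono.shift`). From
`refinedH 1 0` on, consecutive `h`-polynomials `f, g` therefore satisfy `Im (g * conj f) > 0` there
(`crossIm_refinedH_pos`), and a Hermite–Biehler argument (`interlaces_of_crossIm_pos`) turns this
into real-rootedness and interlacing. -/

/-! ### Cross products and families of increasing argument -/

/-- The form `Im (w * conj v)`, nonnegative when the argument of `w` exceeds that of `v` by at
most `π`. -/
def crossIm (v w : ℂ) : ℝ := v.re * w.im - v.im * w.re

theorem crossIm_smul_smul (c d : ℝ) (v w : ℂ) :
    crossIm (c * v) (d * w) = c * d * crossIm v w := by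
  simp [crossIm]; ring

theorem crossIm_sum_sum {ι κ : Type*} (s : Finset ι) (t : Finset κ) (v : ι → ℂ) (w : κ → ℂ) :
    crossIm (∑ i ∈ s, v i) (∑ j ∈ t, w j) = ∑ i ∈ s, ∑ j ∈ t, crossIm (v i) (w j) := by
  simp only [crossIm, Complex.re_sum, Complex.im_sum, Finset.sum_mul_sum, Finset.sum_sub_distrib]

theorem crossIm_sum_sum_nonneg {ι κ : Type*} {s : Finset ι} {t : Finset κ} {v : ι → ℂ} {w : κ → ℂ}
    (h : ∀ i ∈ s, ∀ j ∈ t, 0 ≤ crossIm (v i) (w j)) :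
    0 ≤ crossIm (∑ i ∈ s, v i) (∑ j ∈ t, w j) := by
  rw [crossIm_sum_sum]
  exact Finset.sum_nonneg fun i hi => Finset.sum_nonneg fun j hj => h i hi j hj

theorem crossIm_mul_mul_left (z v w : ℂ) :
    crossIm (z * v) (z * w) = Complex.normSq z * crossIm v w := by
  simp [crossIm, Complex.normSq_apply]; ring

theorem crossIm_self_mul (z v : ℂ) : crossIm v (z * v) = z.im * Complex.normSq v := by
  simp [crossIm, Complex.normSq_apply]; ring

theorem crossIm_add_left (u v w : ℂ) : crossIm (u + v) w = crossIm u w + crossIm v w := by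
  simp [crossIm]; ring

theorem crossIm_add_right (u v w : ℂ) : crossIm u (v + w) = crossIm u v + crossIm u w := by
  simp [crossIm]; ring

theorem crossIm_self (v : ℂ) : crossIm v v = 0 := by
  simp [crossIm]; ring

theorem crossIm_swap (v w : ℂ) : crossIm v w = -crossIm w v := by
  simp [crossIm]; ring

/-- The pairings of `z * A` with `C` occur in both orders and cancel, so nothing is needed about `A`
against `C`. -/
theorem crossIm_shift_nonneg {z A B C : ℂ} (hz : 0 < z.im) (hAB : 0 ≤ crossIm A B)
    (hBC : 0 ≤ crossIm B C) (hBA : 0 ≤ crossIm B (z * A)) (hCB : 0 ≤ crossIm C (z * B)) :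
    0 ≤ crossIm (z * A + (B + C)) (z * A + (z * B + C)) := by
  have h1 : 0 ≤ crossIm B (z * B) := by
    rw [crossIm_self_mul]; exact mul_nonneg hz.le (Complex.normSq_nonneg _)
  have h2 : 0 ≤ crossIm (z * A) (z * B) := by
    rw [crossIm_mul_mul_left]; exact mul_nonneg (Complex.normSq_nonneg _) hAB
  simp only [crossIm_add_left, crossIm_add_right, crossIm_self]
  linarith [crossIm_swap (z * A) C]

theorem crossIm_mul_shift_nonneg {z A B C : ℂ} (hz : 0 < z.im) (hAB : 0 ≤ crossIm A B)
    (hBC : 0 ≤ crossIm B C) (hBA : 0 ≤ crossIm B (z * A)) (hCB : 0 ≤ crossIm C (z * B)) :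
    0 ≤ crossIm (z * A + (z * B + C)) (z * (z * A + (B + C))) := by
  have h1 : 0 ≤ crossIm (z * A) (z * B) := by
    rw [crossIm_mul_mul_left]; exact mul_nonneg (Complex.normSq_nonneg _) hAB
  have h2 : 0 ≤ crossIm (z * B) (z * (z * A)) := by
    rw [crossIm_mul_mul_left]; exact mul_nonneg (Complex.normSq_nonneg _) hBA
  have h3 : 0 ≤ crossIm (z * B) (z * C) := by
    rw [crossIm_mul_mul_left]; exact mul_nonneg (Complex.normSq_nonneg _) hBC
  have h4 : 0 ≤ crossIm (z * A + C) (z * (z * A + C)) := by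
    rw [crossIm_self_mul]; exact mul_nonneg hz.le (Complex.normSq_nonneg _)
  simp only [mul_add, crossIm_add_left, crossIm_add_right, crossIm_self] at h4 ⊢
  linarith

/-- The vectors `a 0, …, a m, z * a 0` have increasing arguments, spanning at most a half plane. -/
def ArgMono (z : ℂ) (m : ℕ) (a : ℕ → ℂ) : Prop :=
  ∀ i j, i ≤ j → j ≤ m → 0 ≤ crossIm (a i) (a j) ∧ 0 ≤ crossIm (a j) (z * a i)

theorem sum_range_split (m i j : ℕ) (hij : i ≤ j) (hj : j ≤ m) (f : ℕ → ℂ) :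
    ∑ k ∈ Finset.range m, f k = ∑ k ∈ Finset.range i, f k +
      (∑ k ∈ Finset.Ico i j, f k + ∑ k ∈ Finset.Ico j m, f k) := by
  rw [Finset.sum_Ico_consecutive _ hij hj, Finset.sum_range_add_sum_Ico _ (hij.trans hj)]

/-- For `i ≤ j`, cutting the sum at `i` and `j` into blocks `A`, `B`, `C` makes entries `i` and `j`
differ only in whether `B` carries the factor `z`. Bilinearity lifts the hypotheses on `a` to the
blocks. -/
theorem ArgMono.shift {z : ℂ} (hz : 0 < z.im) {m : ℕ} {a : ℕ → ℂ} (ha : ArgMono z m a) :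
    ArgMono z (m + 1) fun i =>
      ∑ j ∈ Finset.range (m + 1), (if j < i then z else 1) * a j := by
  intro i j hij hj
  have hi : ∑ k ∈ Finset.range (m + 1), (if k < i then z else 1) * a k =
      z * ∑ k ∈ Finset.range i, a k +
        (∑ k ∈ Finset.Ico i j, a k + ∑ k ∈ Finset.Ico j (m + 1), a k) := by
    rw [sum_range_split _ i j hij hj, Finset.mul_sum]
    congr 1
    · refine Finset.sum_congr rfl fun k hk => ?_
      rw [if_pos (Finset.mem_range.1 hk)]
    congr 1
    · refine Finset.sum_congr rfl fun k hk => ?_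
      rw [if_neg (by have := Finset.mem_Ico.1 hk; omega), one_mul]
    · refine Finset.sum_congr rfl fun k hk => ?_
      rw [if_neg (by have := Finset.mem_Ico.1 hk; omega), one_mul]
  have hj' : ∑ k ∈ Finset.range (m + 1), (if k < j then z else 1) * a k =
      z * ∑ k ∈ Finset.range i, a k +
        (z * ∑ k ∈ Finset.Ico i j, a k + ∑ k ∈ Finset.Ico j (m + 1), a k) := by
    rw [sum_range_split _ i j hij hj, Finset.mul_sum, Finset.mul_sum]
    congr 1
    · refine Finset.sum_congr rfl fun k hk => ?_
      rw [if_pos (by have := Finset.mem_range.1 hk; omega)]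
    congr 1
    · refine Finset.sum_congr rfl fun k hk => ?_
      rw [if_pos (by have := Finset.mem_Ico.1 hk; omega)]
    · refine Finset.sum_congr rfl fun k hk => ?_
      rw [if_neg (by have := Finset.mem_Ico.1 hk; omega), one_mul]
  have hAB : 0 ≤ crossIm (∑ k ∈ Finset.range i, a k) (∑ k ∈ Finset.Ico i j, a k) :=
    crossIm_sum_sum_nonneg fun k hk l hl => by
      simp only [Finset.mem_range, Finset.mem_Ico] at hk hl
      exact (ha k l (by omega) (by omega)).1
  have hBC : 0 ≤ crossIm (∑ k ∈ Finset.Ico i j, a k) (∑ k ∈ Finset.Ico j (m + 1), a k) :=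
    crossIm_sum_sum_nonneg fun k hk l hl => by
      simp only [Finset.mem_Ico] at hk hl
      exact (ha k l (by omega) (by omega)).1
  have hBA : 0 ≤ crossIm (∑ k ∈ Finset.Ico i j, a k) (z * ∑ k ∈ Finset.range i, a k) := by
    rw [Finset.mul_sum]
    exact crossIm_sum_sum_nonneg fun k hk l hl => by
      simp only [Finset.mem_range, Finset.mem_Ico] at hk hl
      exact (ha l k (by omega) (by omega)).2
  have hCB : 0 ≤ crossIm (∑ k ∈ Finset.Ico j (m + 1), a k) (z * ∑ k ∈ Finset.Ico i j, a k) := by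
    rw [Finset.mul_sum]
    exact crossIm_sum_sum_nonneg fun k hk l hl => by
      simp only [Finset.mem_Ico] at hk hl
      exact (ha l k (by omega) (by omega)).2
  simp only [hi, hj']
  exact ⟨crossIm_shift_nonneg hz hAB hBC hBA hCB, crossIm_mul_shift_nonneg hz hAB hBC hBA hCB⟩

theorem ArgMono.weighted {z : ℂ} {m : ℕ} {a : ℕ → ℂ} (ha : ArgMono z m a) {c : ℕ → ℝ}
    (hc : ∀ i, 0 ≤ c i) : ArgMono z m fun i => c i * a i := by
  intro i j hij hj
  obtain ⟨h1, h2⟩ := ha i j hij hj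
  constructor
  · rw [crossIm_smul_smul]; exact mul_nonneg (mul_nonneg (hc i) (hc j)) h1
  · rw [mul_left_comm, crossIm_smul_smul]; exact mul_nonneg (mul_nonneg (hc j) (hc i)) h2

/-! ### The refined polynomials in the upper half plane -/

noncomputable section

/-- The refined `h`-polynomials of the partition lattices: `refinedH m 0` turns out to be the
`h`-polynomial of the lattice of partitions of an `(m + 1)`-element set. -/
def refinedH : ℕ → ℕ → ℝ[X]
  | 0, _ => 1
  | m + 1, i => ∑ j ∈ Finset.range (m + 1),
      (if j < i then X else 1) * (C ((j + 1 : ℕ) : ℝ) * refinedH m j)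

end

theorem aeval_refinedH_succ (z : ℂ) (m i : ℕ) :
    aeval z (refinedH (m + 1) i) = ∑ j ∈ Finset.range (m + 1),
      (if j < i then z else 1) * (((j + 1 : ℕ) : ℝ) * aeval z (refinedH m j)) := by
  rw [refinedH, map_sum]
  refine Finset.sum_congr rfl fun j _ => ?_
  split_ifs <;> simp

theorem argMono_refinedH {z : ℂ} (hz : 0 < z.im) (m : ℕ) :
    ArgMono z m fun i => aeval z (refinedH m i) := by
  induction m with
  | zero =>
    intro i j _ _
    simp [refinedH, crossIm, hz.le]
  | succ m ih =>
    simp only [aeval_refinedH_succ]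
    exact (ih.weighted fun i => Nat.cast_nonneg (i + 1)).shift hz

/-- Every index of the sum lies below `m + 1`, so each term carries `X`. This fails for `refinedH
0`, which is why the strict inequality below starts one level up. -/
theorem refinedH_self (m : ℕ) : refinedH (m + 1) (m + 1) = X * refinedH (m + 1) 0 := by
  simp only [refinedH, Finset.mul_sum]
  refine Finset.sum_congr rfl fun j hj => ?_
  simp [Finset.mem_range.1 hj]

/-- All terms of the sum for `refinedH (m + 2) 0` contribute nonnegatively, and the last one
strictly: it is a positive multiple of `z * refinedH (m + 1) 0`. -/
theorem crossIm_refinedH_pos {z : ℂ} (hz : 0 < z.im) (m : ℕ)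
    (h0 : aeval z (refinedH (m + 1) 0) ≠ 0) :
    0 < crossIm (aeval z (refinedH (m + 1) 0)) (aeval z (refinedH (m + 2) 0)) := by
  rw [aeval_refinedH_succ z (m + 1)]
  have h := argMono_refinedH hz (m + 1)
  have := crossIm_sum_sum {()} (Finset.range (m + 1 + 1))
    (fun _ => aeval z (refinedH (m + 1) 0))
    fun j => (if j < 0 then z else 1) * (((j + 1 : ℕ) : ℝ) * aeval z (refinedH (m + 1) j))
  simp only [Finset.sum_singleton] at this
  rw [this]
  have key : ∀ j, crossIm (aeval z (refinedH (m + 1) 0))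
      ((if j < 0 then z else 1) * (((j + 1 : ℕ) : ℝ) * aeval z (refinedH (m + 1) j))) =
      ((j + 1 : ℕ) : ℝ) * crossIm (aeval z (refinedH (m + 1) 0)) (aeval z (refinedH (m + 1) j)) := by
    intro j
    have := crossIm_smul_smul 1 ((j + 1 : ℕ) : ℝ) (aeval z (refinedH (m + 1) 0))
      (aeval z (refinedH (m + 1) j))
    simpa using this
  refine Finset.sum_pos' (fun j hj => ?_) ⟨m + 1, by simp, ?_⟩
  · rw [key]
    exact mul_nonneg (Nat.cast_nonneg _) (h 0 j (Nat.zero_le _)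
      (by have := Finset.mem_range.1 hj; omega)).1
  · rw [key, refinedH_self, map_mul, aeval_X, crossIm_self_mul]
    exact mul_pos (by positivity) (mul_pos hz (Complex.normSq_pos.2 h0))

theorem aeval_refinedH_zero_ne_zero {z : ℂ} (hz : 0 < z.im) (m : ℕ) :
    aeval z (refinedH m 0) ≠ 0 := by
  induction m with
  | zero => simp [refinedH]
  | succ m ih =>
    cases m with
    | zero => simp [refinedH]
    | succ m =>
      intro h
      have := crossIm_refinedH_pos hz m ih
      rw [h] at this
      simp [crossIm] at this

theorem coeff_refinedH_nonneg (m i k : ℕ) : 0 ≤ (refinedH m i).coeff k := by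
  induction m generalizing i k with
  | zero =>
    simp only [refinedH, coeff_one]
    split_ifs <;> simp
  | succ m ih =>
    rw [refinedH, finsetSum_coeff]
    refine Finset.sum_nonneg fun j _ => ?_
    split_ifs
    · cases k with
      | zero => simp
      | succ k =>
        rw [coeff_X_mul, coeff_C_mul]
        exact mul_nonneg (Nat.cast_nonneg _) (ih _ _)
    · rw [one_mul, coeff_C_mul]
      exact mul_nonneg (Nat.cast_nonneg _) (ih _ _)

/-! ### Hermite–Biehler: from arguments to interlacing roots -/

open Filter Topology

theorem lt_countP_of_lt {l : List ℝ} (hl : l.Pairwise (· ≥ ·)) {i : ℕ} (hi : i < l.length)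
    {r : ℝ} (hr : r < l[i]) : i < l.countP (r < ·) := by
  have h : (l.take (i + 1)).countP (r < ·) = (l.take (i + 1)).length := by
    rw [List.countP_eq_length]
    intro a ha
    obtain ⟨k, hk, rfl⟩ := List.getElem_of_mem ha
    simp only [List.length_take, List.getElem_take] at hk ⊢
    rcases Nat.lt_or_ge k i with h | h
    · exact decide_eq_true (hr.trans_le (List.pairwise_iff_getElem.1 hl k i (by omega) hi h))
    · obtain rfl : k = i := by omega
      exact decide_eq_true hr
  have h2 := List.Sublist.countP_le (p := (r < ·)) (List.take_sublist (i + 1) l)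
  rw [h, List.length_take] at h2
  omega

theorem countP_le_of_ge {l : List ℝ} (hl : l.Pairwise (· ≥ ·)) {i : ℕ} (hi : i < l.length)
    {r : ℝ} (hr : l[i] ≤ r) : l.countP (r < ·) ≤ i := by
  have h : (l.drop i).countP (r < ·) = 0 := by
    rw [List.countP_eq_zero]
    intro a ha
    obtain ⟨k, hk, rfl⟩ := List.getElem_of_mem ha
    simp only [List.length_drop, List.getElem_drop] at hk ⊢
    simp only [decide_eq_true_eq, not_lt]
    rcases Nat.eq_zero_or_pos k with rfl | h
    · simpa using hr
    · exact (List.pairwise_iff_getElem.1 hl i (i + k) hi (by omega) (by omega)).trans hr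
  rw [← List.take_append_drop i l, List.countP_append, h, add_zero]
  exact List.countP_le_length.trans (by simp)

theorem exists_lt_forall_lt (s : Finset ℝ) : ∃ r, ∀ a ∈ s, r < a := by
  obtain ⟨b, hb⟩ := s.finite_toSet.bddBelow
  exact ⟨b - 1, fun a ha => by linarith [hb ha]⟩

/-- Two decreasing lists alternate as soon as, above every generic threshold, the second one has
as many entries as the first, or exactly one more. -/
theorem alternate_of_countP {l l' : List ℝ} (hl : l.Pairwise (· ≥ ·)) (hl' : l'.Pairwise (· ≥ ·))
    (h : ∀ r, r ∉ l → r ∉ l' → l'.countP (r < ·) = l.countP (r < ·) ∨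
      l'.countP (r < ·) = l.countP (r < ·) + 1) :
    (l'.length = l.length ∨ l'.length = l.length + 1) ∧
      (∀ (i : ℕ) (hf : i < l.length) (hg : i < l'.length), l[i] ≤ l'[i]) ∧
      (∀ (i : ℕ) (hf : i < l.length) (hg : i + 1 < l'.length), l'[i + 1] ≤ l[i]) := by
  classical
  have gen : ∀ a b : ℝ, a < b → ∃ r, a < r ∧ r < b ∧ r ∉ l ∧ r ∉ l' := by
    intro a b hab
    obtain ⟨r, hr, hr'⟩ := (Set.Ioo_infinite hab).exists_notMem_finset (l ++ l').toFinset
    simp only [List.mem_toFinset, List.mem_append, not_or] at hr'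
    exact ⟨r, hr.1, hr.2, hr'⟩
  refine ⟨?_, ?_, ?_⟩
  -- A threshold below all entries turns counts into lengths.
  · obtain ⟨r, hr⟩ := exists_lt_forall_lt (l ++ l').toFinset
    simp only [List.mem_toFinset, List.mem_append] at hr
    have h1 : l.countP (r < ·) = l.length :=
      List.countP_eq_length.2 fun a ha => decide_eq_true (hr a (Or.inl ha))
    have h2 : l'.countP (r < ·) = l'.length :=
      List.countP_eq_length.2 fun a ha => decide_eq_true (hr a (Or.inr ha))
    rw [← h1, ← h2]
    exact h r (fun hm => lt_irrefl _ (hr r (Or.inl hm))) fun hm => lt_irrefl _ (hr r (Or.inr hm))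
  · intro i hf hg
    by_contra! hlt
    obtain ⟨r, h1, h2, h3, h4⟩ := gen _ _ hlt
    have := lt_countP_of_lt hl hf h2
    have := countP_le_of_ge hl' hg h1.le
    have := h r h3 h4
    omega
  · intro i hf hg
    by_contra! hlt
    obtain ⟨r, h1, h2, h3, h4⟩ := gen _ _ hlt
    have := lt_countP_of_lt hl' hg h2
    have := countP_le_of_ge hl hf h1.le
    have := h r h3 h4
    omega

theorem realRooted_of_ne_zero {f : ℝ[X]} (h : ∀ z : ℂ, 0 < z.im → aeval z f ≠ 0) :
    RealRooted f := by
  refine Or.inr fun z hz => ?_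
  by_contra him
  rcases lt_or_gt_of_ne him with h1 | h1
  · refine h (starRingEnd ℂ z) (by simpa using h1) ?_
    rw [aeval_conj, hz, map_zero]
  · exact h z h1 hz

theorem splits_of_realRooted {f : ℝ[X]} (hf : RealRooted f) : f.Splits := by
  rcases hf with rfl | hf
  · simp
  refine Splits.of_splits_map (algebraMap ℝ ℂ) (IsAlgClosed.splits _) fun z hz => ?_
  have : aeval z f = 0 := by
    rw [mem_roots'] at hz
    simpa [IsRoot, eval_map_algebraMap] using hz.2
  exact ⟨z.re, Complex.ext (by simp) (by simp [hf z this])⟩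

/-- The sum of the arguments of `z - a`, over the elements `a` of a multiset of reals. -/
noncomputable def argSum (s : Multiset ℝ) (z : ℂ) : ℝ := (s.map fun a : ℝ => (z - a).arg).sum

theorem prod_sub_eq (s : Multiset ℝ) (z : ℂ) :
    (s.map fun a : ℝ => z - a).prod =
      ((s.map fun a : ℝ => ‖z - a‖).prod : ℝ) * Complex.exp (argSum s z * Complex.I) := by
  induction s using Multiset.induction_on with
  | empty => simp [argSum]
  | cons a s ih =>
    simp only [argSum, Multiset.map_cons, Multiset.prod_cons, Multiset.sum_cons] at ih ⊢
    rw [ih, Complex.ofReal_mul, Complex.ofReal_add, add_mul, Complex.exp_add,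
      mul_mul_mul_comm, Complex.norm_mul_exp_arg_mul_I]

theorem continuousOn_argSum (s : Multiset ℝ) : ContinuousOn (argSum s) {z | 0 < z.im} := by
  induction s using Multiset.induction_on with
  | empty => exact (continuousOn_const (c := (0 : ℝ))).congr fun z _ => by simp [argSum]
  | cons a s ih =>
    have : argSum (a ::ₘ s) = fun z : ℂ => (z - a).arg + argSum s z := by
      funext z; simp [argSum]
    rw [this]
    refine ContinuousOn.add (fun z hz => ?_) ih
    refine (ContinuousAt.comp (Complex.continuousAt_arg ?_) (by fun_prop)).continuousWithinAt
    exact Complex.mem_slitPlane_iff.2 (Or.inr (by simpa using (ne_of_gt hz)))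

/-- Dividing `r + I - a` by `r > 0` keeps its argument and gives a quantity tending to `1`. -/
theorem tendsto_argSum_atTop (s : Multiset ℝ) :
    Tendsto (fun r : ℝ => argSum s (r + Complex.I)) atTop (𝓝 0) := by
  induction s using Multiset.induction_on with
  | empty => simp [argSum]
  | cons a s ih =>
    have : ∀ z, argSum (a ::ₘ s) z = (z - a).arg + argSum s z := fun z => by simp [argSum]
    simp only [this]
    rw [← add_zero (0 : ℝ)]
    refine Tendsto.add ?_ ih
    have hlim : Tendsto (fun r : ℝ => (1 : ℂ) + ((r⁻¹ : ℝ) : ℂ) * (Complex.I - a)) atTop (𝓝 1) := by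
      have := ((Complex.continuous_ofReal.tendsto 0).comp tendsto_inv_atTop_zero).mul_const
        (Complex.I - a)
      simpa using this.const_add 1
    have harg := (Complex.continuousAt_arg Complex.one_mem_slitPlane).tendsto.comp hlim
    rw [Complex.arg_one] at harg
    refine harg.congr' ?_
    filter_upwards [eventually_gt_atTop 0] with r hr
    rw [Function.comp, ← Complex.arg_real_mul _ hr]
    congr 1
    have : (r : ℂ) ≠ 0 := by exact_mod_cast hr.ne'
    push_cast
    field_simp
    ring

/-- Approaching `r` from above, a root to the right of `r` contributes `π` and one to the left
contributes `0`. -/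
theorem tendsto_argSum_real (s : Multiset ℝ) {r : ℝ} (hr : r ∉ s) :
    Tendsto (fun ε : ℝ => argSum s (r + ε * Complex.I)) (𝓝[>] 0)
      (𝓝 (s.countP (r < ·) * Real.pi)) := by
  induction s using Multiset.induction_on with
  | empty => simp [argSum]
  | cons a s ih =>
    simp only [Multiset.mem_cons, not_or] at hr
    have : ∀ z, argSum (a ::ₘ s) z = (z - a).arg + argSum s z := fun z => by simp [argSum]
    simp only [this]
    have hlim : Tendsto (fun ε : ℝ => (r : ℂ) + ε * Complex.I - a) (𝓝[>] 0) (𝓝 (r - a)) := by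
      have : Continuous fun ε : ℝ => (r : ℂ) + ε * Complex.I - a := by fun_prop
      simpa using (this.tendsto 0).mono_left nhdsWithin_le_nhds
    rcases lt_or_gt_of_ne hr.1 with h | h
    · rw [Multiset.countP_cons_of_pos _ h, Nat.cast_add_one, add_mul, one_mul, add_comm]
      refine Tendsto.add ?_ (ih hr.2)
      -- The limit lies on the branch cut of `arg`; approach from nonnegative imaginary part selects
      -- the value `π`.
      refine (Complex.tendsto_arg_nhdsWithin_im_nonneg_of_re_neg_of_im_zero
        (z := (r - a : ℂ)) (by simpa using h) (by simp)).comp ?_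
      refine tendsto_nhdsWithin_iff.2 ⟨hlim, ?_⟩
      filter_upwards [self_mem_nhdsWithin] with ε hε
      simpa using (le_of_lt hε)
    · rw [Multiset.countP_cons_of_neg _ (not_lt.2 h.le), ← zero_add (_ * Real.pi)]
      refine Tendsto.add ?_ (ih hr.2)
      have hpos : 0 < r - a := sub_pos.2 h
      have harg := (Complex.continuousAt_arg (x := (r - a : ℂ))
        (Complex.mem_slitPlane_iff.2 (Or.inl (by simpa using hpos)))).tendsto.comp hlim
      rwa [← Complex.ofReal_sub, Complex.arg_ofReal_of_nonneg hpos.le] at harg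

theorem aeval_eq_of_splits {f : ℝ[X]} (hf : f.Splits) (z : ℂ) :
    aeval z f = ((f.leadingCoeff * (f.roots.map fun a : ℝ => ‖z - a‖).prod : ℝ) : ℂ) *
      Complex.exp (argSum f.roots z * Complex.I) := by
  conv_lhs => rw [hf.eq_prod_roots]
  rw [map_mul, aeval_C, map_multiset_prod, Multiset.map_map, Complex.ofReal_mul, mul_assoc,
    ← prod_sub_eq]
  simp

theorem crossIm_exp (c d s t : ℝ) :
    crossIm (c * Complex.exp (s * Complex.I)) (d * Complex.exp (t * Complex.I)) =
      c * d * Real.sin (t - s) := by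
  rw [crossIm_smul_smul, crossIm, Complex.exp_ofReal_mul_I_re, Complex.exp_ofReal_mul_I_re,
    Complex.exp_ofReal_mul_I_im, Complex.exp_ofReal_mul_I_im, Real.sin_sub]
  ring

theorem prod_norm_nonneg (s : Multiset ℝ) (z : ℂ) :
    0 ≤ (s.map fun a : ℝ => ‖z - a‖).prod :=
  Multiset.prod_nonneg fun x hx => by
    obtain ⟨a, _, rfl⟩ := Multiset.mem_map.1 hx
    exact norm_nonneg _

/-- The difference of arguments has positive sine, so it never takes the values `0` and `π`. It is
continuous on a connected set and tends to `0` along `r + I`, which confines it to the interval. -/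
theorem argSum_sub_mem_Ioo {f g : ℝ[X]} (hf : f.Splits) (hg : g.Splits)
    (hf0 : 0 ≤ f.leadingCoeff) (hg0 : 0 ≤ g.leadingCoeff)
    (h : ∀ z : ℂ, 0 < z.im → 0 < crossIm (aeval z f) (aeval z g)) {z : ℂ} (hz : 0 < z.im) :
    argSum g.roots z - argSum f.roots z ∈ Set.Ioo 0 Real.pi := by
  set φ : ℂ → ℝ := fun z => argSum g.roots z - argSum f.roots z with hφ
  have hsin : ∀ z : ℂ, 0 < z.im → 0 < Real.sin (φ z) := by
    intro z hz
    have := h z hz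
    rw [aeval_eq_of_splits hf, aeval_eq_of_splits hg, crossIm_exp] at this
    refine pos_of_mul_pos_right this ?_
    exact mul_nonneg (mul_nonneg hf0 (prod_norm_nonneg _ _))
      (mul_nonneg hg0 (prod_norm_nonneg _ _))
  have hconn : IsPreconnected (φ '' {z : ℂ | 0 < z.im}) :=
    ((convex_halfSpace_im_gt 0).isPreconnected).image _
      ((continuousOn_argSum _).sub (continuousOn_argSum _))
  have hord := hconn.ordConnected
  have hlim : Tendsto (fun r : ℝ => φ (r + Complex.I)) atTop (𝓝 0) := by
    simpa using (tendsto_argSum_atTop g.roots).sub (tendsto_argSum_atTop f.roots)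
  obtain ⟨r, hr⟩ := (hlim.eventually (Ioo_mem_nhds (neg_lt_zero.2 Real.pi_pos)
    Real.pi_pos)).exists
  have hr0 : 0 < φ (r + Complex.I) := by
    by_contra! hle
    exact absurd (hsin (r + Complex.I) (by simp))
      (not_lt.2 (Real.sin_nonpos_of_nonpos_of_neg_pi_le hle hr.1.le))
  have hmem : φ (r + Complex.I) ∈ φ '' {z : ℂ | 0 < z.im} := ⟨_, by simp, rfl⟩
  have hmem' : φ z ∈ φ '' {z : ℂ | 0 < z.im} := ⟨_, hz, rfl⟩
  constructor
  · by_contra! hle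
    obtain ⟨w, hw, hw0⟩ := hord.out hmem' hmem ⟨hle, hr0.le⟩
    have := hsin w hw
    rw [hw0, Real.sin_zero] at this
    exact lt_irrefl _ this
  · by_contra! hle
    obtain ⟨w, hw, hw0⟩ := hord.out hmem hmem' ⟨hr.2.le, hle⟩
    have := hsin w hw
    rw [hw0, Real.sin_pi] at this
    exact lt_irrefl _ this

theorem countP_roots_of_crossIm_pos {f g : ℝ[X]} (hf : f.Splits) (hg : g.Splits)
    (hf0 : 0 ≤ f.leadingCoeff) (hg0 : 0 ≤ g.leadingCoeff)
    (h : ∀ z : ℂ, 0 < z.im → 0 < crossIm (aeval z f) (aeval z g)) {r : ℝ}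
    (hrf : r ∉ f.roots) (hrg : r ∉ g.roots) :
    g.roots.countP (r < ·) = f.roots.countP (r < ·) ∨
      g.roots.countP (r < ·) = f.roots.countP (r < ·) + 1 := by
  have hlim := (tendsto_argSum_real g.roots hrg).sub (tendsto_argSum_real f.roots hrf)
  have hmem := isClosed_Icc.mem_of_tendsto (s := Set.Icc 0 Real.pi) hlim (by
    filter_upwards [self_mem_nhdsWithin] with ε hε
    exact Set.Ioo_subset_Icc_self
      (argSum_sub_mem_Ioo hf hg hf0 hg0 h (by simpa using hε)))
  rw [← sub_mul] at hmem
  have h1 := nonneg_of_mul_nonneg_left hmem.1 Real.pi_pos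
  have h2 := le_of_mul_le_mul_right (hmem.2.trans_eq (one_mul _).symm) Real.pi_pos
  have h1' : f.roots.countP (r < ·) ≤ g.roots.countP (r < ·) := by
    exact_mod_cast sub_nonneg.1 h1
  have h2' : g.roots.countP (r < ·) ≤ 1 + f.roots.countP (r < ·) := by
    exact_mod_cast sub_le_iff_le_add.1 h2
  omega

/-- A Hermite–Biehler criterion for interlacing. -/
theorem interlaces_of_crossIm_pos {f g : ℝ[X]}
    (hf0 : 0 ≤ f.leadingCoeff) (hg0 : 0 ≤ g.leadingCoeff)
    (h : ∀ z : ℂ, 0 < z.im → 0 < crossIm (aeval z f) (aeval z g)) : Interlaces f g := by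
  have hf : RealRooted f := realRooted_of_ne_zero fun z hz h0 => by
    have := h z hz
    simp [h0, crossIm] at this
  have hg : RealRooted g := realRooted_of_ne_zero fun z hz h0 => by
    have := h z hz
    simp [h0, crossIm] at this
  refine ⟨hf, hg, Or.inr (Or.inr ?_)⟩
  have hcoe : ∀ p : ℝ[X], (decRoots p : Multiset ℝ) = p.roots := fun p => Multiset.sort_eq _ _
  refine alternate_of_countP (Multiset.pairwise_sort _ _) (Multiset.pairwise_sort _ _)
    fun r hrf hrg => ?_
  have := countP_roots_of_crossIm_pos (splits_of_realRooted hf) (splits_of_realRooted hg) hf0 hg0 h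
    (r := r) (by rw [← hcoe]; exact hrf) (by rw [← hcoe]; exact hrg)
  rwa [← hcoe, ← hcoe, Multiset.coe_countP, Multiset.coe_countP] at this

theorem interlaces_refinedH (m : ℕ) : Interlaces (refinedH m 0) (refinedH (m + 1) 0) := by
  cases m with
  | zero =>
    have h : refinedH 0 0 = 1 := by simp [refinedH]
    have h' : refinedH (0 + 1) 0 = 1 := by simp [refinedH]
    have h1 : RealRooted (1 : ℝ[X]) := Or.inr fun z hz => by simp at hz
    rw [h, h']
    exact ⟨h1, h1, Or.inr (Or.inr (by simp [decRoots]))⟩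
  | succ m =>
    exact interlaces_of_crossIm_pos (coeff_refinedH_nonneg _ _ _) (coeff_refinedH_nonneg _ _ _)
      fun z hz => crossIm_refinedH_pos hz m (aeval_refinedH_zero_ne_zero hz _)

/-! ### Chain sums of finite posets -/

theorem mem_orderComplex {L : Type*} [PartialOrder L] [Fintype L] {c : Finset L} :
    c ∈ orderComplex L ↔ IsChain (· ≤ ·) (c : Set L) := by
  simp [orderComplex]

theorem orderComplex_map {L M : Type*} [PartialOrder L] [Fintype L] [PartialOrder M] [Fintype M]
    (e : L ≃o M) :
    orderComplex M = (orderComplex L).map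
      ⟨Finset.map e.toEquiv.toEmbedding, Finset.map_injective _⟩ := by
  ext c
  simp only [Finset.mem_map, mem_orderComplex, Function.Embedding.coeFn_mk]
  constructor
  · intro hc
    refine ⟨c.map e.symm.toEquiv.toEmbedding, ?_, ?_⟩
    · rw [Finset.coe_map]
      exact e.symm.monotone.isChain_image hc
    · ext x
      simp [Finset.mem_map_equiv]
  · rintro ⟨d, hd, rfl⟩
    rw [Finset.coe_map]
    exact e.monotone.isChain_image hd

theorem maxChainCard_congr {L M : Type*} [PartialOrder L] [Fintype L] [PartialOrder M] [Fintype M]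
    (e : L ≃o M) : maxChainCard M = maxChainCard L := by
  simp [maxChainCard, orderComplex_map e, Finset.sup_map, Function.comp_def]

theorem chainCount_congr {L M : Type*} [PartialOrder L] [Fintype L] [PartialOrder M] [Fintype M]
    (e : L ≃o M) (i : ℕ) : chainCount M i = chainCount L i := by
  simp [chainCount, orderComplex_map e, Finset.filter_map]

theorem hPolynomial_congr {L M : Type*} [PartialOrder L] [Fintype L] [PartialOrder M] [Fintype M]
    (e : L ≃o M) : hPolynomial M = hPolynomial L := by
  simp only [hPolynomial, maxChainCard_congr e, chainCount_congr e]

/-- The chain polynomial of a finite poset, evaluated at a real number. -/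
noncomputable def chainSum (L : Type*) [PartialOrder L] [Fintype L] (t : ℝ) : ℝ :=
  ∑ c ∈ orderComplex L, t ^ c.card

theorem chainSum_congr {L M : Type*} [PartialOrder L] [Fintype L] [PartialOrder M] [Fintype M]
    (e : L ≃o M) (t : ℝ) : chainSum M t = chainSum L t := by
  simp [chainSum, orderComplex_map e]

theorem eval_hPolynomial (L : Type*) [PartialOrder L] [Fintype L] {x : ℝ} (hx : x ≠ 1) :
    (hPolynomial L).eval x = (1 - x) ^ maxChainCard L * chainSum L (x / (1 - x)) := by
  have hx' : 1 - x ≠ 0 := sub_ne_zero.2 hx.symm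
  have hle : ∀ c ∈ orderComplex L, c.card ∈ Finset.range (maxChainCard L + 1) := fun c hc =>
    Finset.mem_range.2 (Nat.lt_succ_of_le (Finset.le_sup (f := Finset.card) hc))
  rw [hPolynomial, eval_finsetSum, chainSum, ← Finset.sum_fiberwise_of_maps_to hle,
    Finset.mul_sum]
  refine Finset.sum_congr rfl fun i hi => ?_
  have hi' : i ≤ maxChainCard L := Nat.lt_succ_iff.1 (Finset.mem_range.1 hi)
  have hsum : ∑ c ∈ (orderComplex L).filter (fun c => c.card = i), (x / (1 - x)) ^ c.card =
      chainCount L i * (x / (1 - x)) ^ i := by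
    rw [Finset.sum_congr rfl fun c hc => by rw [(Finset.mem_filter.1 hc).2], Finset.sum_const,
      nsmul_eq_mul, chainCount]
  rw [hsum]
  simp only [eval_mul, eval_C, eval_pow, eval_X, eval_sub, eval_one]
  rw [pow_sub₀ _ hx' hi', div_pow]
  field_simp

theorem exists_isLeast_of_isChain {L : Type*} [PartialOrder L] {c : Finset L} (hc : IsChain (· ≤ ·) (c : Set L))
    (hne : c.Nonempty) : ∃ a, IsLeast (c : Set L) a := by
  obtain ⟨a, ha⟩ := c.exists_minimal hne
  refine ⟨a, ha.1, fun b hb => ?_⟩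
  rcases hc.total ha.1 hb with h | h
  · exact h
  · exact ha.2 hb h

section Recursion

variable {L : Type*} [PartialOrder L] [Fintype L]

open Classical in
/-- The chains of a poset contained in a given subset. -/
noncomputable def chainsIn (S : Set L) : Finset (Finset L) :=
  (orderComplex L).filter fun c => (c : Set L) ⊆ S

theorem mem_chainsIn {S : Set L} {c : Finset L} :
    c ∈ chainsIn S ↔ IsChain (· ≤ ·) (c : Set L) ∧ (c : Set L) ⊆ S := by
  simp [chainsIn, mem_orderComplex]

theorem chainSum_subtype (S : Set L) [Fintype S] (t : ℝ) :
    chainSum S t = ∑ c ∈ chainsIn S, t ^ c.card := by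
  classical
  refine Finset.sum_nbij (fun c => c.map (Function.Embedding.subtype _)) ?_ ?_ ?_ ?_
  · intro c hc
    rw [mem_orderComplex] at hc
    rw [mem_chainsIn, Finset.coe_map]
    refine ⟨(Subtype.mono_coe _).isChain_image hc, ?_⟩
    rintro _ ⟨x, _, rfl⟩
    exact x.2
  · exact (Finset.map_injective _).injOn
  · intro c hc
    have hc' := mem_chainsIn.1 (Finset.mem_coe.1 hc)
    refine ⟨c.subtype (· ∈ S), ?_, ?_⟩
    · rw [Finset.mem_coe, mem_orderComplex]
      intro a ha b hb hab
      simp only [Finset.mem_coe, Finset.mem_subtype] at ha hb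
      exact hc'.1 ha hb fun h => hab (Subtype.ext h)
    · exact Finset.subtype_map_of_mem fun x hx => hc'.2 hx
  · intro c _
    rw [Finset.card_map]

open Classical in
theorem sum_chains_isLeast (a : L) (t : ℝ) :
    ∑ c ∈ (orderComplex L).filter (fun c : Finset L => IsLeast (c : Set L) a), t ^ c.card =
      t * ∑ c ∈ chainsIn (Set.Ioi a), t ^ c.card := by
  rw [Finset.mul_sum]
  symm
  refine Finset.sum_bij' (fun c _ => insert a c) (fun c _ => c.erase a) ?_ ?_ ?_ ?_ ?_
  · intro c hc
    rw [mem_chainsIn] at hc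
    rw [Finset.mem_filter, mem_orderComplex, Finset.coe_insert]
    refine ⟨hc.1.insert fun b hb _ => Or.inl (hc.2 hb).le, Set.mem_insert _ _, ?_⟩
    rintro b (rfl | hb)
    · exact le_rfl
    · exact (hc.2 hb).le
  · intro c hc
    rw [Finset.mem_filter, mem_orderComplex] at hc
    rw [mem_chainsIn]
    refine ⟨hc.1.mono (Finset.coe_subset.2 (Finset.erase_subset _ _)), fun b hb => ?_⟩
    rw [Finset.mem_coe, Finset.mem_erase] at hb
    exact lt_of_le_of_ne (hc.2.2 hb.2) hb.1.symm
  · intro c hc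
    exact Finset.erase_insert fun h => lt_irrefl a ((mem_chainsIn.1 hc).2 h)
  · intro c hc
    exact Finset.insert_erase (Finset.mem_filter.1 hc).2.1
  · intro c hc
    rw [Finset.card_insert_of_notMem fun h => lt_irrefl a ((mem_chainsIn.1 hc).2 h), pow_succ']

open Classical in
theorem sum_chainsIn_Ici (a : L) (t : ℝ) :
    ∑ c ∈ chainsIn (Set.Ici a), t ^ c.card =
      ∑ c ∈ (orderComplex L).filter (fun c : Finset L => IsLeast (c : Set L) a), t ^ c.card +
        ∑ c ∈ chainsIn (Set.Ioi a), t ^ c.card := by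
  rw [← Finset.sum_filter_add_sum_filter_not _ (fun c => a ∈ c)]
  congr 1
  · refine Finset.sum_congr (Finset.ext fun c => ?_) fun _ _ => rfl
    simp only [Finset.mem_filter, mem_chainsIn, mem_orderComplex]
    exact ⟨fun h => ⟨h.1.1, h.2, fun b hb => h.1.2 hb⟩, fun h => ⟨⟨h.1, fun b hb => h.2.2 hb⟩, h.2.1⟩⟩
  · refine Finset.sum_congr (Finset.ext fun c => ?_) fun _ _ => rfl
    simp only [Finset.mem_filter, mem_chainsIn]
    refine ⟨fun h => ⟨h.1.1, fun b hb => ?_⟩, fun h => ⟨⟨h.1, fun b hb => (h.2 hb).le⟩,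
      fun ha => lt_irrefl a (h.2 ha)⟩⟩
    exact lt_of_le_of_ne (h.1.2 hb) fun hab => h.2 (hab ▸ hb)

open Classical in
-- Each nonempty chain has exactly one least element; the `1` is the empty chain.
theorem chainSum_sub_one (t : ℝ) :
    chainSum L t - 1 =
      ∑ a : L, ∑ c ∈ (orderComplex L).filter (fun c : Finset L => IsLeast (c : Set L) a), t ^ c.card := by
  simp only [Finset.sum_filter]
  rw [Finset.sum_comm, sub_eq_iff_eq_add, chainSum,
    ← Finset.sum_erase_add _ _ (mem_orderComplex.2 (by simp) : (∅ : Finset L) ∈ orderComplex L),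
    ← Finset.sum_erase_add (orderComplex L) (fun c => ∑ a : L, if IsLeast (c : Set L) a then _ else _)
      (mem_orderComplex.2 (by simp) : (∅ : Finset L) ∈ orderComplex L)]
  have h0 : ∑ a : L, (if IsLeast ((∅ : Finset L) : Set L) a then t ^ (∅ : Finset L).card else 0)
      = 0 := Finset.sum_eq_zero fun a _ => if_neg fun h => by simpa using h.1
  rw [h0, add_zero, Finset.card_empty, pow_zero]
  congr 1
  refine Finset.sum_congr rfl fun c hc => ?_
  rw [Finset.mem_erase, mem_orderComplex, ← Finset.nonempty_iff_ne_empty] at hc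
  obtain ⟨a, ha⟩ := exists_isLeast_of_isChain hc.2 hc.1
  rw [Finset.sum_eq_single_of_mem a (Finset.mem_univ _), if_pos ha]
  exact fun b _ hb => if_neg fun h => hb (h.unique ha)

open Classical in
/-- Summation over the least element of a chain. -/
theorem chainSum_recursion (t : ℝ) :
    (1 + t) * (chainSum L t - 1) = t * ∑ a : L, chainSum (Set.Ici a) t := by
  rw [chainSum_sub_one, Finset.mul_sum, Finset.mul_sum]
  -- With `E` the sum over chains strictly above `a`, chains with least element `a` give `t * E` and
  -- those in `Ici a` give `t * E + E`.
  refine Finset.sum_congr rfl fun a _ => ?_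
  rw [chainSum_subtype, sum_chainsIn_Ici, sum_chains_isLeast]
  ring

end Recursion

/-! ### Equivalence relations counted by number of classes -/

noncomputable instance Setoid.instFintypeOfFinite {α : Type*} [Finite α] : Fintype (Setoid α) :=
  have : Finite (Setoid α) :=
    Finite.of_injective (fun s : Setoid α => (s.r : α → α → Prop)) fun _ _ h =>
      Setoid.ext fun a b => iff_of_eq (congrFun (congrFun h a) b)
  Fintype.ofFinite _

/-- Transport of equivalence relations along a bijection. -/
def Setoid.orderIsoOfEquiv {α β : Type*} (e : α ≃ β) : Setoid α ≃o Setoid β where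
  toFun s := s.comap e.symm
  invFun s := s.comap e
  left_inv s := by ext; simp [Setoid.comap_rel]
  right_inv s := by ext; simp [Setoid.comap_rel]
  map_rel_iff' {s t} := by
    constructor
    · intro h x y hxy
      have hs : s.comap e.symm (e x) (e y) := by
        rwa [Setoid.comap_rel, e.symm_apply_apply, e.symm_apply_apply]
      have ht := h hs
      rwa [Equiv.coe_fn_mk, Setoid.comap_rel, e.symm_apply_apply, e.symm_apply_apply] at ht
    · intro h x y hxy
      exact h hxy

/-- The number of classes of an equivalence relation. -/
noncomputable def Setoid.numClasses {α : Type*} (s : Setoid α) : ℕ := Nat.card (Quotient s)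

theorem Setoid.numClasses_orderIsoOfEquiv {α β : Type*} (e : α ≃ β) (s : Setoid α) :
    (Setoid.orderIsoOfEquiv e s).numClasses = s.numClasses :=
  (Nat.card_congr (Quotient.congr e fun a b => by
    change s a b ↔ s (e.symm (e a)) (e.symm (e b))
    simp)).symm

/-- The sum of a function of the number of classes over all equivalence relations. -/
noncomputable def classSum (α : Type*) [Finite α] (g : ℕ → ℝ) : ℝ :=
  ∑ s : Setoid α, g s.numClasses

theorem classSum_congr {α β : Type*} [Finite α] [Finite β] (e : α ≃ β) (g : ℕ → ℝ) :
    classSum α g = classSum β g :=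
  Fintype.sum_equiv (Setoid.orderIsoOfEquiv e).toEquiv _ _ fun s => by
    rw [← Setoid.numClasses_orderIsoOfEquiv e s]; rfl

/-- The class of each element, when a new element is put into the class `q` of `s`, or into a
class of its own. -/
def Setoid.optionClass {α : Type*} (s : Setoid α) (q : Option (Quotient s)) :
    Option α → Option (Quotient s)
  | none => q
  | some a => some (Quotient.mk s a)

theorem Setoid.comap_ker_optionClass {α : Type*} (s : Setoid α) (q : Option (Quotient s)) :
    (Setoid.ker (s.optionClass q)).comap some = s := by
  ext a b
  rw [Setoid.comap_rel, Setoid.ker_def]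
  simp only [Setoid.optionClass, Option.some.injEq, Quotient.eq]

/-- An equivalence relation on `Option α` is determined by its restriction to `α` and by the class
that `none` joins, if any. -/
theorem Setoid.bijective_ker_optionClass (α : Type*) :
    Function.Bijective fun p : Σ s : Setoid α, Option (Quotient s) =>
      Setoid.ker (p.1.optionClass p.2) := by
  constructor
  · rintro ⟨s, q⟩ ⟨s', q'⟩ h
    have hs : s = s' := by
      rw [← s.comap_ker_optionClass q, ← s'.comap_ker_optionClass q']
      exact congrArg _ h
    subst hs
    have key : ∀ a, q = some (Quotient.mk s a) ↔ q' = some (Quotient.mk s a) := fun a =>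
      iff_of_eq (congrArg (fun r : Setoid (Option α) => r none (some a)) h)
    have : q = q' := by
      rcases q with _ | q
      · rcases q' with _ | q'
        · rfl
        · induction q' using Quotient.inductionOn with
          | _ a => exact (key a).2 rfl
      · induction q using Quotient.inductionOn with
        | _ a => exact ((key a).1 rfl).symm
    rw [this]
  · intro r
    by_cases h : ∃ a, r none (some a)
    · obtain ⟨a, ha⟩ := h
      refine ⟨⟨r.comap some, some (Quotient.mk _ a)⟩, ?_⟩
      ext x y
      rw [Setoid.ker_def]
      rcases x with _ | x <;> rcases y with _ | y <;>
        simp only [Setoid.optionClass, Option.some.injEq, Quotient.eq, Setoid.comap_rel]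
      · exact iff_of_true trivial (r.refl' _)
      · exact ⟨fun h => r.trans' ha h, fun h => r.trans' (r.symm' ha) h⟩
      · exact ⟨fun h => r.trans' h (r.symm' ha), fun h => r.trans' h ha⟩
    · push Not at h
      refine ⟨⟨r.comap some, none⟩, ?_⟩
      ext x y
      rw [Setoid.ker_def]
      rcases x with _ | x <;> rcases y with _ | y <;>
        simp only [Setoid.optionClass, Option.some.injEq, Quotient.eq, Setoid.comap_rel]
      · exact iff_of_true trivial (r.refl' _)
      · exact iff_of_false (by simp) (h y)
      · exact iff_of_false (by simp) fun h' => h x (r.symm' h')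

theorem Setoid.numClasses_ker_optionClass {α : Type*} [Finite α] (s : Setoid α)
    (q : Option (Quotient s)) :
    (Setoid.ker (s.optionClass q)).numClasses =
      if q = none then s.numClasses + 1 else s.numClasses := by
  rw [Setoid.numClasses, Nat.card_congr (Setoid.quotientKerEquivRange _)]
  split_ifs with h
  · subst h
    have : Set.range (s.optionClass none) = Set.univ := by
      refine Set.eq_univ_of_forall fun x => ?_
      rcases x with _ | x
      · exact ⟨none, rfl⟩
      · induction x using Quotient.inductionOn with
        | _ a => exact ⟨some a, rfl⟩
    rw [this, Nat.card_congr (Equiv.Set.univ _), Finite.card_option, Setoid.numClasses]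
  · obtain ⟨q, rfl⟩ := Option.ne_none_iff_exists'.1 h
    have : Set.range (s.optionClass (some q)) = Set.range some := by
      ext x
      constructor
      · rintro ⟨_ | a, rfl⟩
        · exact ⟨q, rfl⟩
        · exact ⟨_, rfl⟩
      · rintro ⟨x, rfl⟩
        induction x using Quotient.inductionOn with
        | _ a => exact ⟨some a, rfl⟩
    rw [this, Nat.card_congr (Equiv.ofInjective _ (Option.some_injective _)).symm,
      Setoid.numClasses]

/-- The operator describing the addition of one element to a set that is partitioned. -/
def stirlingOp (g : ℕ → ℝ) (m : ℕ) : ℝ := m * g m + g (m + 1)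

/-- With `m` classes present, the new element joins one of them in `m` ways, or opens class `m + 1`.
-/
theorem classSum_option (α : Type*) [Finite α] (g : ℕ → ℝ) :
    classSum (Option α) g = classSum α (stirlingOp g) := by
  classical
  have : ∀ s : Setoid α, Fintype (Quotient s) := fun s => Fintype.ofFinite _
  rw [classSum, ← (Equiv.ofBijective _ (Setoid.bijective_ker_optionClass α)).sum_comp,
    Fintype.sum_sigma, classSum]
  refine Finset.sum_congr rfl fun s _ => ?_
  simp only [Equiv.ofBijective_apply, Setoid.numClasses_ker_optionClass, Fintype.sum_option,
    stirlingOp]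
  simp [Setoid.numClasses, Nat.card_eq_fintype_card, add_comm]

theorem classSum_fin (n : ℕ) (g : ℕ → ℝ) : classSum (Fin n) g = (stirlingOp^[n] g) 0 := by
  induction n generalizing g with
  | zero =>
    have : Unique (Setoid (Fin 0)) := ⟨⟨⊤⟩, fun s => Setoid.ext fun a => a.elim0⟩
    rw [classSum, Fintype.sum_unique]
    simp [Setoid.numClasses]
  | succ n ih =>
    rw [classSum_congr (finSuccEquiv n), classSum_option, ih, Function.iterate_succ_apply]

/-! ### Chains of equivalence relations -/

theorem chainSum_Ici_setoid {α : Type*} [Finite α] (s : Setoid α) [Fintype (Set.Ici s)] (t : ℝ) :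
    chainSum (Set.Ici s) t = chainSum (Setoid (Fin s.numClasses)) t := by
  refine (chainSum_congr ?_ t).symm
  exact (Setoid.correspondence s).trans (Setoid.orderIsoOfEquiv (Finite.equivFin _))

theorem chainSum_setoid (n : ℕ) (t : ℝ) :
    (1 + t) * (chainSum (Setoid (Fin n)) t - 1) =
      t * classSum (Fin n) fun k => chainSum (Setoid (Fin k)) t := by
  rw [chainSum_recursion, classSum]
  simp only [chainSum_Ici_setoid]

theorem Setoid.numClasses_strictAnti {α : Type*} [Finite α] {s t : Setoid α} (h : s < t) :
    t.numClasses < s.numClasses := by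
  let f : Quotient s → Quotient t := Quotient.map' id fun a b hab => h.le hab
  have hf : Function.Surjective f := fun q => by
    induction q using Quotient.inductionOn with
    | _ a => exact ⟨Quotient.mk s a, rfl⟩
  refine lt_of_le_of_ne (Nat.card_le_card_of_surjective f hf) fun heq => h.not_ge ?_
  have hinj : Function.Injective f :=
    ((Nat.bijective_iff_surjective_and_card f).2 ⟨hf, heq.symm⟩).1
  intro a b hab
  exact Quotient.exact (hinj (show f (Quotient.mk s a) = f (Quotient.mk s b) from
    Quotient.sound hab))

/-- Along a chain the number of classes is injective with values in `1, …, n`; merging longer and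
longer initial segments attains the bound. For `n = 0` the one-point lattice would give `1`. -/
theorem maxChainCard_setoid (n : ℕ) (hn : 1 ≤ n) : maxChainCard (Setoid (Fin n)) = n := by
  classical
  have : NeZero n := ⟨by omega⟩
  apply le_antisymm
  · refine Finset.sup_le fun c hc => ?_
    rw [mem_orderComplex] at hc
    have hmaps : ∀ s ∈ c, s.numClasses ∈ Finset.Icc 1 n := fun s _ => by
      rw [Finset.mem_Icc, Setoid.numClasses]
      refine ⟨Nat.card_pos, ?_⟩
      simpa using Nat.card_le_card_of_surjective (Quotient.mk s) Quotient.mk_surjective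
    have hinj : Set.InjOn Setoid.numClasses (c : Set (Setoid (Fin n))) := by
      intro s hs t ht hst
      by_contra hne
      rcases hc hs ht hne with h | h
      · exact (Setoid.numClasses_strictAnti (lt_of_le_of_ne h hne)).ne' hst
      · exact (Setoid.numClasses_strictAnti (lt_of_le_of_ne h (Ne.symm hne))).ne hst
    simpa using Finset.card_le_card_of_injOn _ hmaps hinj
  · let f : Fin n → Setoid (Fin n) := fun i => Setoid.ker fun a => max a i
    have hmono : Monotone f := fun i j hij a b hab => by
      have hab' : max a i = max b i := hab
      change max a j = max b j
      rw [← max_eq_right hij, ← max_assoc, hab', max_assoc]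
    have hinj : Function.Injective f := by
      have hlt : ∀ i j, i < j → f i ≠ f j := fun i j hij h => by
        have h1 : f j i j := show max i j = max j j by rw [max_self, max_eq_right hij.le]
        rw [← h] at h1
        have h2 : max i i = max j i := h1
        rw [max_self, max_eq_left hij.le] at h2
        exact hij.ne h2
      intro i j h
      by_contra hne
      rcases lt_or_gt_of_ne hne with h' | h'
      · exact hlt i j h' h
      · exact hlt j i h' h.symm
    have hmem : Finset.univ.map ⟨f, hinj⟩ ∈ orderComplex (Setoid (Fin n)) := by
      rw [mem_orderComplex, Finset.coe_map]
      exact hmono.isChain_image (isChain_of_trichotomous _)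
    have hle := Finset.le_sup (f := Finset.card) hmem
    rwa [Finset.card_map, Finset.card_univ, Fintype.card_fin] at hle

/-! ### Finite partitions as equivalence relations -/

/-- The equivalence relation of lying in the same part. -/
def Finpartition.toSetoid {α : Type*} [DecidableEq α] {s : Finset α} (P : Finpartition s) :
    Setoid s :=
  Setoid.ker fun a : s => P.part a

theorem Finpartition.toSetoid_rel {α : Type*} [DecidableEq α] {s : Finset α} (P : Finpartition s)
    (a b : s) : P.toSetoid a b ↔ (a : α) ∈ P.part b := by
  rw [P.mem_part_iff_part_eq_part a.2 b.2]; rfl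

theorem Finpartition.toSetoid_le_toSetoid {α : Type*} [DecidableEq α] {s : Finset α}
    {P Q : Finpartition s} : P.toSetoid ≤ Q.toSetoid ↔ P ≤ Q := by
  constructor
  · intro h b hb
    obtain ⟨x, hx⟩ := P.nonempty_of_mem_parts hb
    have hxs := P.subset hb hx
    refine ⟨Q.part x, Q.part_mem.2 hxs, fun y hy => ?_⟩
    refine (Q.toSetoid_rel ⟨y, P.subset hb hy⟩ ⟨x, hxs⟩).1 (h ((P.toSetoid_rel _ _).2 ?_))
    rwa [P.part_eq_of_mem hb hx]
  · intro h a b hab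
    obtain ⟨c, hc, hle⟩ := h (P.part_mem.2 b.2)
    rw [Q.toSetoid_rel, Q.part_eq_of_mem hc (hle (P.mem_part b.2))]
    exact hle ((P.toSetoid_rel a b).1 hab)

theorem Finpartition.toSetoid_surjective {α : Type*} [DecidableEq α] (s : Finset α) :
    Function.Surjective (Finpartition.toSetoid (s := s)) := by
  classical
  intro r
  -- `Finpartition.ofSetSetoid` takes a relation on the ambient type, so `r` is extended by equality
  -- outside `s`.
  let r' : Setoid α :=
    { r := fun a b => a = b ∨ ∃ ha hb, r ⟨a, ha⟩ ⟨b, hb⟩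
      iseqv := by
        refine ⟨fun a => Or.inl rfl, ?_, ?_⟩
        · rintro a b (rfl | ⟨ha, hb, h⟩)
          · exact Or.inl rfl
          · exact Or.inr ⟨hb, ha, r.symm' h⟩
        · rintro a b c (rfl | ⟨ha, hb, h⟩) (rfl | ⟨hb', hc, h'⟩)
          · exact Or.inl rfl
          · exact Or.inr ⟨hb', hc, h'⟩
          · exact Or.inr ⟨ha, hb, h⟩
          · exact Or.inr ⟨ha, hc, r.trans' h h'⟩ }
  refine ⟨Finpartition.ofSetSetoid r' s, ?_⟩
  ext a b
  rw [Finpartition.toSetoid_rel, Finpartition.mem_part_ofSetSetoid_iff_rel]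
  constructor
  · rintro ⟨_, _, h | ⟨ha, hb, h⟩⟩
    · rw [Subtype.ext h]
    · exact r.symm' h
  · exact fun h => ⟨b.2, a.2, Or.inr ⟨b.2, a.2, r.symm' h⟩⟩

/-- Partitions of a finite set correspond to equivalence relations on it. -/
noncomputable def Finpartition.orderIsoSetoid {α : Type*} [DecidableEq α] (s : Finset α) :
    Finpartition s ≃o Setoid s :=
  RelIso.ofSurjective (OrderEmbedding.ofMapLEIff Finpartition.toSetoid
    fun _ _ => Finpartition.toSetoid_le_toSetoid) (Finpartition.toSetoid_surjective s)

theorem hPolynomial_partitionLattice (n : ℕ) :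
    hPolynomial (PartitionLattice n) = hPolynomial (Setoid (Fin n)) :=
  (hPolynomial_congr ((Finpartition.orderIsoSetoid _).trans
    (Setoid.orderIsoOfEquiv (Finset.equivFinOfCardEq (by simp))))).symm

/-! ### Identification of the `h`-polynomials -/

theorem iterate_stirlingOp_succ (g : ℕ → ℝ) (d k : ℕ) :
    (stirlingOp^[d + 1] g) k = k * (stirlingOp^[d] g) k + (stirlingOp^[d] g) (k + 1) := by
  rw [Function.iterate_succ_apply']; rfl

/-- The indicator of `1` is fixed by `stirlingOp` away from `0`: a nonempty set has exactly one
partition with a single block. -/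
theorem iterate_stirlingOp_single (d k : ℕ) (hk : 1 ≤ k) :
    (stirlingOp^[d] fun m => if m = 1 then 1 else 0) k = if k = 1 then 1 else 0 := by
  induction d generalizing k with
  | zero => rfl
  | succ d ih =>
    rw [iterate_stirlingOp_succ, ih k hk, ih (k + 1) (by omega), if_neg (by omega : k + 1 ≠ 1)]
    split_ifs with h
    · simp [h]
    · simp

theorem classSum_fin_succ (m : ℕ) (g : ℕ → ℝ) :
    classSum (Fin (m + 1)) g = (stirlingOp^[m] g) 1 := by
  rw [classSum_fin, iterate_stirlingOp_succ]; simp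

theorem chainSum_setoid_one {t : ℝ} : chainSum (Setoid (Fin 1)) t = 1 + t := by
  have h := chainSum_setoid 1 t
  rw [classSum_fin_succ 0, Function.iterate_zero, id] at h
  linarith

/-- The values `x * F k`, with `F k` the chain sum of the lattice of partitions of a `k`-element set
at `x / (1 - x)`, corrected at `k = 1`. -/
noncomputable def weightedChainSum (x : ℝ) (k : ℕ) : ℝ :=
  x * chainSum (Setoid (Fin k)) (x / (1 - x)) + if k = 1 then 1 else 0

/-- Since `t / (1 + t) = x`, the chain recursion becomes `F n = 1 + x ∑ π, F |π|`; the constant `1`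
is absorbed into the sum as the indicator of having one block. -/
theorem chainSum_setoid_succ {x : ℝ} (hx : x ≠ 1) (m : ℕ) :
    chainSum (Setoid (Fin (m + 1))) (x / (1 - x)) = (stirlingOp^[m] (weightedChainSum x)) 1 := by
  have hx' : 1 - x ≠ 0 := sub_ne_zero.2 hx.symm
  have h := chainSum_setoid (m + 1) (x / (1 - x))
  have h1 : 1 + x / (1 - x) = 1 / (1 - x) := by field_simp; ring
  have h2 : chainSum (Setoid (Fin (m + 1))) (x / (1 - x)) - 1 =
      x * classSum (Fin (m + 1)) fun k => chainSum (Setoid (Fin k)) (x / (1 - x)) := by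
    rw [h1] at h
    field_simp at h
    exact h
  have h3 : classSum (Fin (m + 1)) (weightedChainSum x) =
      x * (classSum (Fin (m + 1)) fun k => chainSum (Setoid (Fin k)) (x / (1 - x))) +
        classSum (Fin (m + 1)) fun k => if k = 1 then 1 else 0 := by
    simp only [classSum, weightedChainSum, Finset.sum_add_distrib, Finset.mul_sum]
  rw [classSum_fin_succ m fun k => if k = 1 then 1 else 0, iterate_stirlingOp_single m 1 le_rfl,
    if_pos rfl, ← h2, classSum_fin_succ] at h3
  linarith

theorem sum_telescope_ite (x : ℝ) (q : ℕ → ℝ) (i N : ℕ) (hi : i ≤ N) :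
    ∑ j ∈ Finset.range N, (if j < i then x else 1) * (q j - q (j + 1)) =
      x * (q 0 - q i) + (q i - q N) := by
  induction N, hi using Nat.le_induction with
  | base =>
    rw [sub_self, add_zero, ← Finset.sum_range_sub', Finset.mul_sum]
    exact Finset.sum_congr rfl fun j hj => by rw [if_pos (Finset.mem_range.1 hj)]
  | succ N hN ih =>
    rw [Finset.sum_range_succ, ih, if_neg (by omega)]
    ring

/-- Rewriting `stirlingOp` as `(j + 1) * p j = q j - q (j + 1)` makes the recursion of `refinedH`
telescope. The boundary relation `q (m + 1) = x * q 0` then leaves `(1 - x) * q i`. -/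
theorem eval_refinedH {x : ℝ} (hx : x ≠ 1) (m i : ℕ) (hi : i ≤ m) :
    (refinedH m i).eval x =
      (1 - x) ^ (m + 1) * (stirlingOp^[m - i] (weightedChainSum x)) (i + 1) := by
  have hx' : 1 - x ≠ 0 := sub_ne_zero.2 hx.symm
  induction m generalizing i with
  | zero =>
    obtain rfl : i = 0 := by omega
    simp only [refinedH, eval_one, weightedChainSum, Nat.sub_self, Function.iterate_zero, id,
      zero_add, pow_one, chainSum_setoid_one, if_true]
    field_simp
    ring
  | succ m ih =>
    set q : ℕ → ℝ := fun i => (stirlingOp^[m + 1 - i] (weightedChainSum x)) (i + 1) with hq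
    have hstep : ∀ j ∈ Finset.range (m + 1), ((j + 1 : ℕ) : ℝ) *
        (stirlingOp^[m - j] (weightedChainSum x)) (j + 1) = q j - q (j + 1) := fun j hj => by
      have hj' := Finset.mem_range.1 hj
      simp only [hq]
      rw [show m + 1 - j = m - j + 1 by omega, show m + 1 - (j + 1) = m - j by omega,
        iterate_stirlingOp_succ]
      ring
    -- Both ends are chain sums for `m + 2` points; the correction in `weightedChainSum` vanishes
    -- since `m + 2 ≠ 1`.
    have hlast : q (m + 1) = x * q 0 := by
      simp only [hq, Nat.sub_self, Nat.sub_zero, Function.iterate_zero, id, zero_add]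
      rw [← chainSum_setoid_succ hx, weightedChainSum, if_neg (by omega), add_zero]
    have hsum : (refinedH (m + 1) i).eval x = (1 - x) ^ (m + 1) *
        ∑ j ∈ Finset.range (m + 1), (if j < i then x else 1) * (q j - q (j + 1)) := by
      rw [refinedH, eval_finsetSum, Finset.mul_sum]
      refine Finset.sum_congr rfl fun j hj => ?_
      rw [← hstep j hj, eval_mul, eval_mul, eval_C, ih j (by have := Finset.mem_range.1 hj; omega)]
      split_ifs <;> simp only [eval_X, eval_one] <;> ring
    rw [hsum, sum_telescope_ite x q i (m + 1) hi, hlast]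
    ring

theorem hPolynomial_partitionLattice_succ (m : ℕ) :
    hPolynomial (PartitionLattice (m + 1)) = refinedH m 0 := by
  rw [hPolynomial_partitionLattice]
  refine eq_of_infinite_eval_eq _ _ ((Set.finite_singleton (1 : ℝ)).infinite_compl.mono ?_)
  intro x hx
  have hx : x ≠ 1 := hx
  rw [Set.mem_ofPred_eq, eval_hPolynomial _ hx, maxChainCard_setoid _ (by omega),
    chainSum_setoid_succ hx, eval_refinedH hx m 0 (Nat.zero_le m)]
  rfl

theorem corollary4p2 (n : ℕ) (hn : 1 ≤ n) :
    RealRooted (hPolynomial (PartitionLattice n)) ∧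
      Interlaces (hPolynomial (PartitionLattice n)) (hPolynomial (PartitionLattice (n + 1))) := by
  obtain ⟨m, rfl⟩ : ∃ m, n = m + 1 := ⟨n - 1, by omega⟩
  rw [hPolynomial_partitionLattice_succ, hPolynomial_partitionLattice_succ]
  exact ⟨(interlaces_refinedH m).1, interlaces_refinedH m⟩
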